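/- Let $G$ be a finite group. For $k\ge 0$ let $E_kG=G^{*(k+1)}$ be the $(k+1)$-fold join of the discrete space $G$ with itself, on which $G$ acts by left translation on each factor. For a topological space $X$ with an action of $G$, let $\operatorname{ind} X$ be the least $k\ge 0$ such that there is a continuous $G$-equivariant map $X\to E_kG$ (and $\infty$ if there is none). A finite $G$-simplicial complex is a finite simplicial complex on which $G$ acts by simplicial automorphisms; it is free if $G$ acts freely on its geometric realization, and its index is that of its geometric realization. Products of $G$-spaces carry the diagonal action. Suppose that $G$ is neither a cyclic $p$-group for a prime $p$ (the trivial group counts as one) nor isomorphic to a generalized quaternion group $\langle a,b : a^n=b^2,\ a^{2n}=1,\ b^{-1}ab=a^{-1}\rangle$, $n\ge 2$, whose order is a power of $2$. Then there exist finite free $G$-simplicial complexes $\mathcal K_1$ and $\mathcal K_2$ such that \[ \operatorname{ind}\mathcal K_1=\operatorname{ind}\mathcal K_2=1\quad\text{but}\quad \operatorname{ind}(\mathcal K_1\times\mathcal K_2)=0 . \] In particular, $\operatorname{ind}(\mathcal K_1\times\mathcal K_2)\ne\min\{\operatorname{ind}\mathcal K_1,\operatorname{ind}\mathcal K_2\}$.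 -/

import Mathlib

universe u v

/-- A group is *nice* if it is a cyclic `p`-group for some prime `p`, or a generalized quaternion
group `⟨a, b : a ^ n = b ^ 2, a ^ (2 * n) = 1, b⁻¹ * a * b = a⁻¹⟩`, `n ≥ 2`, whose order is a
power of `2`. -/
def IsNiceGroup (G : Type u) [Group G] : Prop :=
  (∃ p : ℕ, p.Prime ∧ IsPGroup p G ∧ IsCyclic G) ∨
    (∃ n : ℕ, 2 ≤ n ∧ Nonempty (G ≃* QuaternionGroup n) ∧ ∃ k : ℕ, Nat.card G = 2 ^ k)

/-- A finite `G`-simplicial complex: a finite abstract simplicial complex on which `G` acts by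
simplicial automorphisms. -/
structure FiniteGComplex (G : Type u) [Group G] where
  /-- the vertices -/
  V : Type v
  /-- the vertex set is finite -/
  finite : Finite V
  /-- the action of `G` on the vertices -/
  action : MulAction G V
  /-- the simplices; every vertex is one -/
  complex : AbstractSimplicialComplex V
  /-- the action maps simplices to simplices -/
  smul_mem : ∀ (g : G) (s : Finset V), s ∈ complex.faces →
    s.map (MulAction.toPerm g).toEmbedding ∈ complex.faces

namespace FiniteGComplex

variable {G : Type u} [Group G]

instance (K : FiniteGComplex.{u, v} G) : MulAction G K.V := K.action

/-- The points of the geometric realization in barycentric coordinates: the convex weights on the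
vertices whose support is a simplex. -/
def points (K : FiniteGComplex.{u, v} G) : Set (K.V → ℝ) :=
  {x | (∀ a, 0 ≤ x a) ∧ ∃ s ∈ K.complex.faces, Function.support x = (s : Set K.V) ∧
    ∑ a ∈ s, x a = 1}

/-- The geometric realization `|K|`, with the topology induced from the finite-dimensional space
of real functions on the vertices. -/
abbrev Realization (K : FiniteGComplex.{u, v} G) : Type v := K.points

theorem smul_mem_points (K : FiniteGComplex.{u, v} G) (g : G) {x : K.V → ℝ} (hx : x ∈ K.points) :
    (fun a => x (g⁻¹ • a)) ∈ K.points := by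
  obtain ⟨h0, s, hs, hsupp, hsum⟩ := hx
  refine ⟨fun a => h0 _, _, K.smul_mem g s hs, ?_, ?_⟩
  · ext a
    have h : x (g⁻¹ • a) ≠ 0 ↔ g⁻¹ • a ∈ s := by
      rw [← Function.mem_support, hsupp, Finset.mem_coe]
    simp only [Function.mem_support, h, Finset.coe_map, Set.mem_image, Finset.mem_coe]
    constructor
    · intro ha
      exact ⟨_, ha, by simp⟩
    · rintro ⟨b, hb, rfl⟩
      simpa using hb
  · simpa using hsum

/-- The action of `G` on `|K|`: the affine extension of the action on the vertices. -/
instance (K : FiniteGComplex.{u, v} G) : MulAction G K.Realization where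
  smul g x := ⟨fun a => x.1 (g⁻¹ • a), K.smul_mem_points g x.2⟩
  one_smul x := Subtype.ext (funext fun a => congrArg x.1 (by simp))
  mul_smul g h x := Subtype.ext (funext fun a => congrArg x.1 (by simp [mul_smul]))

/-- `K` is free if `G` acts freely on the realization `|K|`. -/
def IsFree (K : FiniteGComplex.{u, v} G) : Prop :=
  ∀ (g : G) (x : K.Realization), g • x = x → g = 1

end FiniteGComplex

/-- The `n`-fold simplicial join of a complex with itself: the vertices are `n` disjoint copies of
those of `K`, and a nonempty finite set is a simplex if its part in each copy is empty or a simplex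
of `K`. -/
def joinPower {V : Type u} (K : AbstractSimplicialComplex V) (n : ℕ) :
    AbstractSimplicialComplex (V × Fin n) where
  faces := {s | s.Nonempty ∧ ∀ i : Fin n,
    s.preimage (fun a => (a, i)) (Prod.mk_left_injective i).injOn = ∅ ∨
      s.preimage (fun a => (a, i)) (Prod.mk_left_injective i).injOn ∈ K.faces}
  isRelLowerSet_faces := by
    rintro s ⟨hs, h⟩
    refine ⟨hs, fun t hts ht => ⟨ht, fun i => ?_⟩⟩
    rcases Finset.eq_empty_or_nonempty
      (t.preimage (fun a => (a, i)) (Prod.mk_left_injective i).injOn) with h0 | h0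
    · exact Or.inl h0
    · refine Or.inr ?_
      have hsub : t.preimage (fun a => (a, i)) (Prod.mk_left_injective i).injOn ⊆
          s.preimage (fun a => (a, i)) (Prod.mk_left_injective i).injOn := by
        intro a ha
        rw [Finset.mem_preimage] at ha ⊢
        exact hts ha
      rcases h i with h1 | h1
      · rw [h1, Finset.subset_empty] at hsub
        exact absurd hsub h0.ne_empty
      · exact (K.isRelLowerSet_faces h1).2 hsub h0
  singleton_mem := by
    rintro ⟨b, j⟩
    refine ⟨Finset.singleton_nonempty _, fun i => ?_⟩
    by_cases hij : j = i
    · subst hij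
      refine Or.inr ?_
      convert K.singleton_mem b
      ext a
      simp
    · refine Or.inl ?_
      ext a
      simp [Ne.symm hij]

/-- The discrete (zero-dimensional) complex on a vertex set: the simplices are the vertices. -/
def discreteComplex (V : Type u) : AbstractSimplicialComplex V where
  faces := {s | ∃ a, s = {a}}
  isRelLowerSet_faces := by
    rintro s ⟨a, rfl⟩
    refine ⟨Finset.singleton_nonempty a, fun t hts ht => ⟨a, ?_⟩⟩
    exact (Finset.subset_singleton_iff.mp hts).resolve_left ht.ne_empty
  singleton_mem a := ⟨a, rfl⟩

/-- The action of `G` on `n` copies of `G` by left translation on every copy: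
`g • (h, i) = (g * h, i)`. -/
abbrev layerAction (G : Type u) [Group G] (n : ℕ) : MulAction G (G × Fin n) where
  smul g a := (g * a.1, a.2)
  one_smul a := Prod.ext (one_mul a.1) rfl
  mul_smul g h a := Prod.ext (mul_assoc g h a.1) rfl

/-- The complex `E_k G`, the `(k + 1)`-fold join of the discrete space `G` with itself,
on which `G` acts by left translation. -/
def EComplex (G : Type u) [Group G] [Finite G] (k : ℕ) : FiniteGComplex.{u, u} G where
  V := G × Fin (k + 1)
  finite := inferInstance
  action := layerAction G (k + 1)
  complex := joinPower (discreteComplex G) (k + 1)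
  smul_mem := by
    rintro g s ⟨hs, h⟩
    refine ⟨hs.map, fun i => ?_⟩
    have key : ∀ b : G, b ∈ (s.map (@MulAction.toPerm G (G × Fin (k + 1)) _
        (layerAction G (k + 1)) g).toEmbedding).preimage (fun a => (a, i)) (Prod.mk_left_injective i).injOn ↔ (g⁻¹ * b, i) ∈ s := by
      intro b
      rw [Finset.mem_preimage, Finset.mem_map]
      constructor
      · rintro ⟨⟨c, j⟩, hc, hcb⟩
        have h1 : g * c = b := congrArg Prod.fst hcb
        have h2 : j = i := congrArg Prod.snd hcb
        rw [← h1, ← h2]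
        simpa using hc
      · intro hb
        exact ⟨_, hb, Prod.ext (mul_inv_cancel_left g b) rfl⟩
    rcases h i with h1 | ⟨c, h1⟩
    · refine Or.inl (Finset.eq_empty_of_forall_notMem fun b hb => ?_)
      have h2 := Finset.ext_iff.mp h1 (g⁻¹ * b)
      rw [Finset.mem_preimage] at h2
      exact Finset.notMem_empty _ (h2.mp ((key b).mp hb))
    · refine Or.inr ⟨g * c, Finset.ext fun b => ?_⟩
      have h2 := Finset.ext_iff.mp h1 (g⁻¹ * b)
      rw [Finset.mem_preimage, Finset.mem_singleton] at h2
      rw [key b, h2, Finset.mem_singleton, inv_mul_eq_iff_eq_mul]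

/-- The mapping index of a `G`-space `X`: the least `k` for which there is a continuous
`G`-equivariant map from `X` to `E_k G` (and `⊤` if there is none). -/
noncomputable def mappingIndex (G : Type u) [Group G] [Finite G] (X : Type v) [TopologicalSpace X]
    [MulAction G X] : ℕ∞ :=
  ⨅ (k : ℕ) (_ : ∃ f : X → (EComplex G k).Realization,
    Continuous f ∧ ∀ (g : G) (x : X), f (g • x) = g • f x), (k : ℕ∞)

/-! If `G` has nontrivial subgroups H₁, H₂ such that no conjugate of H₁ meets H₂ nontrivially, take
Kᵢ = G ×_{Hᵢ} E₁Hᵢ, a disjoint union of connected graphs indexed by G/Hᵢ. Reading off components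
gives K₁ × K₂ → G/H₁ × G/H₂. The action on the target is free, so the target maps equivariantly to
`G`, and the product has index 0. Each Kᵢ lies in E₁G, but an equivariant map to the discrete `G`
would be constant on a component, which the nontrivial Hᵢ (up to conjugacy) preserves; so its index
is 1.

Such subgroups exist by Cauchy's theorem if two primes divide |G|. In a p-group, a central subgroup
of order p and any other one will do. If there is no other one, the classical theorem applies
(`AtMostOneSubgroupOfOrder.isNiceGroup`): a self-centralizing normal abelian subgroup is cyclic, say
⟨a⟩, and if b ∉ ⟨a⟩ has b^p ∈ ⟨a⟩, some a^s b is killed by p, contradicting uniqueness, unless p = 2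
and a, b satisfy the quaternion relations. -/

namespace FiniteGComplex

/-! ### Realizations: vertices, paths, locally constant labels -/

variable {G : Type u} [Group G] (K : FiniteGComplex.{u, v} G)

theorem exists_face_iff (x : K.Realization) : ∃ s ∈ K.complex.faces, ∀ a, x.1 a ≠ 0 ↔ a ∈ s := by
  obtain ⟨-, s, hs, hsupp, -⟩ := x.2
  exact ⟨s, hs, fun a => by rw [← Function.mem_support, hsupp, Finset.mem_coe]⟩

theorem exists_ne_zero (x : K.Realization) : ∃ a, x.1 a ≠ 0 := by
  obtain ⟨s, hs, h⟩ := K.exists_face_iff x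
  obtain ⟨a, ha⟩ := (K.complex.isRelLowerSet_faces hs).1
  exact ⟨a, (h a).mpr ha⟩

theorem mem_points_of_face {x : K.V → ℝ} (h0 : ∀ a, 0 ≤ x a) {s : Finset K.V}
    (hs : s ∈ K.complex.faces) (hx : ∀ a, x a ≠ 0 → a ∈ s) (hsum : ∑ a ∈ s, x a = 1) :
    x ∈ K.points := by
  have hsum' : ∑ a ∈ s with x a ≠ 0, x a = 1 := by rw [Finset.sum_filter_ne_zero, hsum]
  refine ⟨h0, s.filter fun a => x a ≠ 0, ?_, ?_, hsum'⟩
  · refine (K.complex.isRelLowerSet_faces hs).2 (Finset.filter_subset _ _) ?_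
    by_contra h
    rw [Finset.not_nonempty_iff_eq_empty] at h
    simp [h] at hsum'
  · ext a
    simpa using hx a

open Classical in
/-- The point of the realization that is a given vertex. -/
noncomputable def vertexPoint (a : K.V) : K.Realization :=
  ⟨Pi.single a 1, K.mem_points_of_face
    (fun b => by rw [Pi.single_apply]; split_ifs <;> norm_num) (K.complex.singleton_mem a)
    (fun b hb => by
      rw [Finset.mem_singleton]
      by_contra h
      exact hb (Pi.single_eq_of_ne h _)) (by simp)⟩

theorem vertexPoint_smul (g : G) (a : K.V) : K.vertexPoint (g • a) = g • K.vertexPoint a := by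
  classical
  refine Subtype.ext (funext fun b => ?_)
  change (Pi.single (g • a) 1 : K.V → ℝ) b = (Pi.single a 1 : K.V → ℝ) (g⁻¹ • b)
  simp only [Pi.single_apply, inv_smul_eq_iff]

open Classical in
theorem joined_vertexPoint {s : Finset K.V} (hs : s ∈ K.complex.faces) {a b : K.V} (ha : a ∈ s)
    (hb : b ∈ s) : Joined (K.vertexPoint a) (K.vertexPoint b) := by
  have hab : {a, b} ∈ K.complex.faces :=
    (K.complex.isRelLowerSet_faces hs).2 (by simp [Finset.insert_subset_iff, ha, hb]) (by simp)
  rcases eq_or_ne a b with rfl | hne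
  · exact Joined.refl _
  have hmem : ∀ t : unitInterval,
      (1 - (t : ℝ)) • (Pi.single a 1 : K.V → ℝ) + (t : ℝ) • (Pi.single b 1 : K.V → ℝ) ∈
        K.points := by
    intro t
    have ht := t.2.1
    have ht' := t.2.2
    refine K.mem_points_of_face (fun c => ?_) hab (fun c hc => ?_) ?_
    · simp only [Pi.add_apply, Pi.smul_apply, Pi.single_apply, smul_eq_mul]
      split_ifs <;> linarith
    · by_contra h
      simp only [Finset.mem_insert, Finset.mem_singleton, not_or] at h
      exact hc (by simp [h.1, h.2])
    · rw [Finset.sum_pair hne]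
      simp [hne, hne.symm]
  refine ⟨⟨⟨fun t => ⟨_, hmem t⟩, ?_⟩, ?_, ?_⟩⟩
  · refine Continuous.subtype_mk ?_ _
    fun_prop
  · exact Subtype.ext (by simp [vertexPoint])
  · exact Subtype.ext (by simp [vertexPoint])

section label

variable {K} {Q : Type*} {q : K.V → Q}

/-- The map on the realization induced by a map on vertices that is constant on simplices. -/
noncomputable def label (q : K.V → Q) (x : K.Realization) : Q :=
  q (K.exists_ne_zero x).choose

theorem label_eq (hq : ∀ s ∈ K.complex.faces, ∀ a ∈ s, ∀ b ∈ s, q a = q b)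
    {x : K.Realization} {a : K.V} (ha : x.1 a ≠ 0) : label q x = q a := by
  obtain ⟨s, hs, h⟩ := K.exists_face_iff x
  exact hq s hs _ ((h _).mp (K.exists_ne_zero x).choose_spec) _ ((h _).mp ha)

theorem label_smul [SMul G Q] (hq : ∀ s ∈ K.complex.faces, ∀ a ∈ s, ∀ b ∈ s, q a = q b)
    (hqG : ∀ (g : G) (a : K.V), q (g • a) = g • q a) (g : G)
    (x : K.Realization) : label q (g • x) = g • label q x := by
  obtain ⟨a, ha⟩ := K.exists_ne_zero x
  have hga : (g • x).1 (g • a) ≠ 0 := by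
    have : (g • x).1 (g • a) = x.1 (g⁻¹ • g • a) := rfl
    rwa [this, inv_smul_smul]
  rw [label_eq hq ha, label_eq hq hga, hqG]

theorem isLocallyConstant_label
    (hq : ∀ s ∈ K.complex.faces, ∀ a ∈ s, ∀ b ∈ s, q a = q b) :
    IsLocallyConstant (label q) := by
  rw [IsLocallyConstant.iff_exists_open]
  intro x
  obtain ⟨a, ha⟩ := K.exists_ne_zero x
  -- The open star of a vertex in the support of `x` is a neighbourhood on which the label is
  -- constant.
  refine ⟨{y | y.1 a ≠ 0}, ?_, ha, fun y hy => ?_⟩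
  · exact isOpen_ne_fun ((continuous_apply a).comp continuous_subtype_val) continuous_const
  · rw [label_eq hq ha, label_eq hq hy]

end label

end FiniteGComplex

open FiniteGComplex

/-! ### The graphs G ×_H E₁H and their indices -/

section

variable {G : Type u} [Group G]

/-- A free action on a set admits an equivariant map to the group. -/
theorem exists_equivariant_map_of_free {X : Type*} [MulAction G X]
    (hfree : ∀ (g : G) (x : X), g • x = x → g = 1) :
    ∃ f : X → G, ∀ g x, f (g • x) = g * f x := by
  -- `r` picks a representative of each orbit. By freeness exactly one group element carries it to
  -- `x`, and uniqueness forces equivariance.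
  let r : X → X := fun x => (Quotient.mk (MulAction.orbitRel G X) x).out
  have hrep : ∀ x : X, ∃ g : G, g • r x = x := fun x =>
    MulAction.orbitRel_apply.mp ((MulAction.orbitRel G X).symm (Quotient.mk_out x))
  choose f hf using hrep
  refine ⟨f, fun g x => ?_⟩
  have hr : r (g • x) = r x :=
    congrArg Quotient.out (Quotient.sound (MulAction.orbitRel_apply.mpr ⟨g, rfl⟩))
  have h1 := hf (g • x)
  rw [hr] at h1
  have h2 : ((g * f x)⁻¹ * f (g • x)) • r x = r x := by
    rw [mul_smul, h1, inv_smul_eq_iff, mul_smul, hf x]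
  exact (inv_mul_eq_one.mp (hfree _ _ h2)).symm

/-- The stabilizer of (aH₁, bH₂) is aH₁a⁻¹ ∩ bH₂b⁻¹, which is trivial by the hypothesis for the
conjugator b⁻¹a. -/
theorem free_prod_quotient {H₁ H₂ : Subgroup G}
    (h : ∀ g : G, ∀ x ∈ H₁, g * x * g⁻¹ ∈ H₂ → x = 1) (g : G) (q : (G ⧸ H₁) × (G ⧸ H₂))
    (hq : g • q = q) : g = 1 := by
  obtain ⟨⟨a⟩, ⟨b⟩⟩ := q
  have h1 : ((g * a : G) : G ⧸ H₁) = a := congrArg Prod.fst hq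
  have h2 : ((g * b : G) : G ⧸ H₂) = b := congrArg Prod.snd hq
  rw [eq_comm, QuotientGroup.eq] at h1 h2
  have := h (b⁻¹ * a) _ h1 (by simpa [mul_assoc] using h2)
  have h3 : g * a = a := (inv_mul_eq_one.mp this).symm
  simpa using h3

variable [Finite G]

theorem eq_of_mem_EComplex_face {k : ℕ} {s : Finset (G × Fin (k + 1))}
    (hs : s ∈ (EComplex G k).complex.faces) {a b : G} {i : Fin (k + 1)}
    (ha : (a, i) ∈ s) (hb : (b, i) ∈ s) : a = b := by
  rcases hs.2 i with h | ⟨c, h⟩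
  · have := Finset.ext_iff.mp h a
    rw [Finset.mem_preimage] at this
    exact absurd (this.mp ha) (Finset.notMem_empty _)
  · have h1 := Finset.ext_iff.mp h a
    have h2 := Finset.ext_iff.mp h b
    rw [Finset.mem_preimage, Finset.mem_singleton] at h1 h2
    rw [h1.mp ha, h2.mp hb]

/-- A simplex has at most one vertex in each copy of `G`, whereas the support of a point fixed by
`g` contains both (a, i) and (g⁻¹a, i). -/
theorem EComplex_isFree (k : ℕ) : (EComplex G k).IsFree := by
  intro g x hgx
  obtain ⟨⟨a, i⟩, ha⟩ := (EComplex G k).exists_ne_zero x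
  obtain ⟨s, hs, h⟩ := (EComplex G k).exists_face_iff x
  have h1 : x.1 (g⁻¹ * a, i) = x.1 (a, i) := congrFun (congrArg Subtype.val hgx) (a, i)
  have h2 : x.1 (g⁻¹ * a, i) ≠ 0 := fun h0 => ha (h1.symm.trans h0)
  have h3 : g⁻¹ * a = a := eq_of_mem_EComplex_face hs ((h _).mp h2) ((h _).mp ha)
  simpa using h3

theorem EComplex_zero_face {s : Finset (EComplex G 0).V} (hs : s ∈ (EComplex G 0).complex.faces)
    (a : (EComplex G 0).V) (ha : a ∈ s) (b : (EComplex G 0).V) (hb : b ∈ s) :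
    (Prod.fst a : G) = Prod.fst b := by
  obtain ⟨a, i⟩ := a
  obtain ⟨b, j⟩ := b
  obtain rfl : i = j := Subsingleton.elim (α := Fin 1) _ _
  exact eq_of_mem_EComplex_face hs ha hb

/-- The subgraph of `E_1 G` whose simplices have all their coordinates in a single left coset of
`H`. It is the induced complex `G ×_H E_1 H`. -/
def cosetGraph (H : Subgroup G) : FiniteGComplex.{u, u} G where
  V := G × Fin 2
  finite := inferInstance
  action := layerAction G 2
  complex :=
    { faces := {s | s ∈ (EComplex G 1).complex.faces ∧ ∀ x ∈ s, ∀ y ∈ s, x.1⁻¹ * y.1 ∈ H}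
      isRelLowerSet_faces := by
        rintro s ⟨hs, h⟩
        refine ⟨((EComplex G 1).complex.isRelLowerSet_faces hs).1, fun t hts ht => ⟨?_, ?_⟩⟩
        · exact ((EComplex G 1).complex.isRelLowerSet_faces hs).2 hts ht
        · exact fun x hx y hy => h x (hts hx) y (hts hy)
      singleton_mem := by
        intro x
        refine ⟨(EComplex G 1).complex.singleton_mem x, fun y hy z hz => ?_⟩
        rw [Finset.mem_singleton] at hy hz
        subst hy hz
        simp }
  smul_mem := by
    rintro g s ⟨hs, h⟩
    refine ⟨(EComplex G 1).smul_mem g s hs, fun x hx y hy => ?_⟩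
    obtain ⟨x', hx', rfl⟩ := Finset.mem_map.mp hx
    obtain ⟨y', hy', rfl⟩ := Finset.mem_map.mp hy
    have : (g * x'.1)⁻¹ * (g * y'.1) ∈ H := by
      have := h x' hx' y' hy'
      simpa [mul_assoc] using this
    exact this

/-- The inclusion of `cosetGraph H` into `E_1 G`. -/
def cosetGraphInclusion (H : Subgroup G) (x : (cosetGraph H).Realization) :
    (EComplex G 1).Realization :=
  ⟨x.1, x.2.1, by
    obtain ⟨s, hs, h⟩ := x.2.2
    exact ⟨s, hs.1, h⟩⟩

theorem continuous_cosetGraphInclusion (H : Subgroup G) :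
    Continuous (cosetGraphInclusion H) :=
  Continuous.subtype_mk continuous_subtype_val _

theorem cosetGraphInclusion_smul (H : Subgroup G) (g : G) (x : (cosetGraph H).Realization) :
    cosetGraphInclusion H (g • x) = g • cosetGraphInclusion H x :=
  rfl

theorem cosetGraph_isFree (H : Subgroup G) : (cosetGraph H).IsFree := fun g x hgx =>
  EComplex_isFree 1 g (cosetGraphInclusion H x) <| by
    rw [← cosetGraphInclusion_smul, hgx]

/-- The left coset of `H` that contains the first coordinate of a vertex. -/
def vertexCoset (H : Subgroup G) (a : (cosetGraph H).V) : G ⧸ H :=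
  QuotientGroup.mk (Prod.fst a)

theorem vertexCoset_eq_of_face (H : Subgroup G) :
    ∀ s ∈ (cosetGraph H).complex.faces, ∀ a ∈ s, ∀ b ∈ s, vertexCoset H a = vertexCoset H b :=
  fun _ hs a ha b hb => QuotientGroup.eq.mpr (hs.2 a ha b hb)

open Classical in
theorem edge_mem_cosetGraph {H : Subgroup G} {a b : G} (hab : a⁻¹ * b ∈ H) :
    ({(a, 0), (b, 1)} : Finset (G × Fin 2)) ∈ (cosetGraph H).complex.faces := by
  refine ⟨⟨by simp, fun i => Or.inr ?_⟩, ?_⟩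
  · fin_cases i
    · exact ⟨a, by ext; simp⟩
    · exact ⟨b, by ext; simp⟩
  · intro x hx y hy
    have hba := H.inv_mem hab
    simp only [Finset.mem_insert, Finset.mem_singleton] at hx hy
    rcases hx with rfl | rfl <;> rcases hy with rfl | rfl <;> simp_all

theorem joined_cosetGraph {H : Subgroup G} {a b : G} (hab : a⁻¹ * b ∈ H) :
    Joined ((cosetGraph H).vertexPoint (a, (0 : Fin 2)))
      ((cosetGraph H).vertexPoint (b, (1 : Fin 2))) := by
  classical
  have h0 : (a, 0) ∈ ({(a, 0), (b, 1)} : Finset (G × Fin 2)) := by simp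
  have h1 : (b, 1) ∈ ({(a, 0), (b, 1)} : Finset (G × Fin 2)) := by simp
  exact (cosetGraph H).joined_vertexPoint (edge_mem_cosetGraph hab) h0 h1

theorem mappingIndex_prod_cosetGraph {H₁ H₂ : Subgroup G}
    (h : ∀ g : G, ∀ x ∈ H₁, g * x * g⁻¹ ∈ H₂ → x = 1) :
    mappingIndex G ((cosetGraph H₁).Realization × (cosetGraph H₂).Realization) = 0 := by
  obtain ⟨f, hf⟩ := exists_equivariant_map_of_free (free_prod_quotient h)
  let c : (cosetGraph H₁).Realization × (cosetGraph H₂).Realization → (G ⧸ H₁) × (G ⧸ H₂) :=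
    fun x => (label (vertexCoset H₁) x.1, label (vertexCoset H₂) x.2)
  have hc : IsLocallyConstant c :=
    ((isLocallyConstant_label (vertexCoset_eq_of_face H₁)).comp_continuous continuous_fst).prodMk
      ((isLocallyConstant_label (vertexCoset_eq_of_face H₂)).comp_continuous continuous_snd)
  have hcG : ∀ (g : G) x, c (g • x) = g • c x := fun g x => Prod.ext
    (label_smul (vertexCoset_eq_of_face H₁) (fun _ _ => rfl) g x.1)
    (label_smul (vertexCoset_eq_of_face H₂) (fun _ _ => rfl) g x.2)
  let vert : G → (EComplex G 0).Realization := fun a => (EComplex G 0).vertexPoint (a, (0 : Fin 1))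
  have hvert : ∀ g a : G, vert (g * a) = g • vert a := fun g a =>
    (EComplex G 0).vertexPoint_smul g (a, (0 : Fin 1))
  refine le_antisymm (iInf₂_le_of_le 0 ⟨fun x => vert (f (c x)), ?_, fun g x => ?_⟩ (by simp))
    bot_le
  · exact (hc.comp fun q => vert (f q)).continuous
  · dsimp only
    rw [hcG, hf, hvert]

theorem mappingIndex_cosetGraph_le (H : Subgroup G) :
    mappingIndex G (cosetGraph H).Realization ≤ 1 :=
  iInf₂_le_of_le 1 ⟨cosetGraphInclusion H, continuous_cosetGraphInclusion H,
    cosetGraphInclusion_smul H⟩ (by simp)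

theorem not_exists_equivariant_cosetGraph_zero {H : Subgroup G} (hH : H ≠ ⊥) :
    ¬ ∃ f : (cosetGraph H).Realization → (EComplex G 0).Realization,
      Continuous f ∧ ∀ (g : G) x, f (g • x) = g • f x := by
  classical
  rintro ⟨f, hf, hfG⟩
  obtain ⟨h, hh, hne⟩ := (Subgroup.bot_or_exists_ne_one H).resolve_left hH
  let F : (cosetGraph H).Realization → G := fun x => label (K := EComplex G 0) Prod.fst (f x)
  have hF : IsLocallyConstant F :=
    (isLocallyConstant_label fun s hs => EComplex_zero_face hs).comp_continuous hf
  have hFG : F (h • (cosetGraph H).vertexPoint (1, (0 : Fin 2))) =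
      h * F ((cosetGraph H).vertexPoint (1, (0 : Fin 2))) := by
    change label _ (f _) = _
    rw [hfG]
    exact label_smul (fun s hs => EComplex_zero_face hs) (fun _ _ => rfl) _ _
  -- Vertices in the same copy of `G` span no edge, so the path from (1, 0) to (h, 0) passes through
  -- (h, 1).
  have h1 : Joined _ _ := joined_cosetGraph (H := H) (a := 1) (b := h) (by simpa using hh)
  have h2 : Joined _ _ := joined_cosetGraph (H := H) (a := h) (b := h) (by simp)
  have h3 : h • (cosetGraph H).vertexPoint (1, (0 : Fin 2)) =
      (cosetGraph H).vertexPoint (h, (0 : Fin 2)) := by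
    refine ((cosetGraph H).vertexPoint_smul h (1, (0 : Fin 2))).symm.trans ?_
    exact congrArg _ (Prod.ext (mul_one h) rfl)
  have h4 : ∀ x y, Joined x y → F x = F y := fun x y ⟨γ⟩ => by
    have := (hF.comp_continuous γ.continuous).apply_eq_of_isPreconnected
      isPreconnected_univ (Set.mem_univ 0) (Set.mem_univ 1)
    simpa using this
  rw [h3, h4 _ _ (h2.trans h1.symm)] at hFG
  exact hne (by simpa using hFG)

theorem mappingIndex_cosetGraph {H : Subgroup G} (hH : H ≠ ⊥) :
    mappingIndex G (cosetGraph H).Realization = 1 := by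
  refine le_antisymm (mappingIndex_cosetGraph_le H) (le_iInf₂ fun k hk => ?_)
  rcases Nat.eq_zero_or_pos k with rfl | hpos
  · exact absurd hk (not_exists_equivariant_cosetGraph_zero hH)
  · exact_mod_cast hpos

end

/-! ### Congruences modulo prime powers -/

section arithmetic

/-- After a factor p is removed from `N` and `j`, the coefficient of s is prime to p, hence
invertible modulo p^n. -/
theorem exists_dvd_mul_add_of_not_sq_dvd {p : ℕ} (hp : p.Prime) (n : ℕ) {N j : ℤ}
    (hN : (p : ℤ) ∣ N) (hN2 : ¬ (p : ℤ) ^ 2 ∣ N) (hj : (p : ℤ) ∣ j) :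
    ∃ s : ℤ, (p : ℤ) ^ n ∣ s * N + j := by
  obtain ⟨N, rfl⟩ := hN
  obtain ⟨j, rfl⟩ := hj
  have hpN : ¬ (p : ℤ) ∣ N := fun h => hN2 (by rw [sq]; exact mul_dvd_mul_left _ h)
  have hcop : IsCoprime N ((p : ℤ) ^ n) :=
    (((Nat.prime_iff_prime_int.mp hp).coprime_iff_not_dvd).mpr hpN).symm.pow_right
  obtain ⟨u, w, h⟩ := hcop
  refine ⟨-(u * j), p * j * w, ?_⟩
  linear_combination (-(p : ℤ) * j) * h

/-- The arithmetic behind the search for an element `a ^ s * b` of order `p`, where `b`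
normalizes the cyclic group generated by `a`. -/
theorem exists_dvd_mul_geom_sum_add_or {p : ℕ} (hp : p.Prime) (n : ℕ) {r j : ℤ}
    (hr : (p : ℤ) ^ n ∣ r ^ p - 1) (hjr : (p : ℤ) ^ n ∣ j * (r - 1)) (hj : (p : ℤ) ∣ j)
    (hr1 : ¬ (p : ℤ) ^ n ∣ r - 1) :
    (∃ s : ℤ, (p : ℤ) ^ n ∣ s * ∑ i ∈ Finset.range p, r ^ i + j) ∨
      (p = 2 ∧ 2 ≤ n ∧ (2 : ℤ) ^ n ∣ r + 1 ∧ (2 : ℤ) ^ (n - 1) ∣ j) := by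
  have hn : n ≠ 0 := by rintro rfl; simp at hr1
  have hpp : Prime (p : ℤ) := Nat.prime_iff_prime_int.mp hp
  have := Fact.mk hp
  -- Fermat: r^p ≡ r modulo p.
  have hpr : (p : ℤ) ∣ r - 1 := by
    have h1 := (dvd_pow_self (p : ℤ) hn).trans hr
    rw [← ZMod.intCast_zmod_eq_zero_iff_dvd] at h1 ⊢
    push_cast at h1 ⊢
    rwa [ZMod.pow_card] at h1
  have hpr' : ¬ (p : ℤ) ∣ r := fun h => hpp.not_dvd_one (by simpa using dvd_sub h hpr)
  rcases hp.eq_two_or_odd' with rfl | hodd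
  · push_cast at *
    have hsum : ∑ i ∈ Finset.range 2, r ^ i = r + 1 := by
      simp [Finset.sum_range_succ, add_comm]
    rw [hsum]
    by_cases h4 : (2 : ℤ) ^ 2 ∣ r + 1
    swap
    · exact Or.inl (by
        simpa using exists_dvd_mul_add_of_not_sq_dvd hp n (N := r + 1)
          (by push_cast; omega) (by exact_mod_cast h4) (by exact_mod_cast hj))
    obtain ⟨m, rfl⟩ := Nat.exists_eq_succ_of_ne_zero hn
    obtain ⟨c, hc⟩ := h4
    -- As r + 1 = 4c, r - 1 is twice the odd number 2c - 1; both hypotheses then lose only one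
    -- factor 2.
    have hcop : IsCoprime ((2 : ℤ) ^ m) (2 * c - 1) :=
      IsCoprime.pow_left ⟨c, -1, by ring⟩
    have hj' : (2 : ℤ) ^ m ∣ j := by
      refine hcop.dvd_of_dvd_mul_right ?_
      refine (mul_dvd_mul_iff_left (two_ne_zero' ℤ)).mp ?_
      have : (2 : ℤ) * (j * (2 * c - 1)) = j * (r - 1) := by linear_combination (-j) * hc
      rw [this, ← pow_succ']
      exact hjr
    have hr' : (2 : ℤ) ^ m ∣ r + 1 := by
      refine hcop.dvd_of_dvd_mul_right ?_
      refine (mul_dvd_mul_iff_left (two_ne_zero' ℤ)).mp ?_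
      have : (2 : ℤ) * ((r + 1) * (2 * c - 1)) = r ^ 2 - 1 := by
        linear_combination (-(r + 1)) * hc
      rw [this, ← pow_succ']
      exact hr
    have hm : m ≠ 0 := by
      rintro rfl
      exact hr1 (by simpa using hpr)
    by_cases hj0 : (2 : ℤ) ^ (m + 1) ∣ j
    · exact Or.inl ⟨0, by simpa using hj0⟩
    by_cases hr0 : (2 : ℤ) ^ (m + 1) ∣ r + 1
    · exact Or.inr ⟨trivial, by omega, hr0, by simpa using hj'⟩
    -- Here `j` and `r + 1` are both odd multiples of 2^m, so their sum is divisible by 2^(m+1).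
    left
    refine ⟨1, ?_⟩
    obtain ⟨x, hx⟩ := hj'
    obtain ⟨y, hy⟩ := hr'
    rw [hx, pow_succ, mul_dvd_mul_iff_left (by positivity)] at hj0
    rw [hy, pow_succ, mul_dvd_mul_iff_left (by positivity)] at hr0
    rw [hx, hy, one_mul, ← mul_add, Nat.succ_eq_add_one, pow_succ,
      mul_dvd_mul_iff_left (by positivity)]
    omega
  · left
    -- Lifting the exponent: for odd p and r ≡ 1 modulo p, the sum is divisible by p exactly once.
    have h1 : emultiplicity (p : ℤ) (∑ i ∈ Finset.range p, r ^ i) = 1 := by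
      simpa using emultiplicity_geom_sum₂_eq_one (y := (1 : ℤ)) hpp hodd hpr hpr'
    obtain ⟨h2, h3⟩ := emultiplicity_eq_coe.mp (h1.trans Nat.cast_one.symm)
    exact exists_dvd_mul_add_of_not_sq_dvd hp n (by simpa using h2) (by simpa using h3) hj

end arithmetic

/-! ### Abelian subgroups of p-groups -/

section groups

variable {G : Type u} [Group G]

theorem zpow_mul_pow_of_conj {a b : G} {r : ℤ} (h : b * a * b⁻¹ = a ^ r) (s : ℤ) (m : ℕ) :
    (a ^ s * b) ^ m = a ^ (s * ∑ i ∈ Finset.range m, r ^ i) * b ^ m := by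
  have hc : ∀ k : ℤ, b * a ^ k = a ^ (r * k) * b := fun k => by
    rw [zpow_mul, ← h, conj_zpow, inv_mul_cancel_right]
  induction m with
  | zero => simp
  | succ m ih =>
    rw [pow_succ', ih, geom_sum_succ, mul_assoc, ← mul_assoc b, hc, mul_assoc _ b, ← pow_succ',
      ← mul_assoc, ← zpow_add]
    congr 2
    ring

theorem pow_conj_of_conj {a b : G} {r : ℤ} (h : b * a * b⁻¹ = a ^ r) (m : ℕ) :
    b ^ m * a * (b ^ m)⁻¹ = a ^ r ^ m := by
  induction m with
  | zero => simp
  | succ m ih =>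
    have : b ^ (m + 1) * a * (b ^ (m + 1))⁻¹ = b * (b ^ m * a * (b ^ m)⁻¹) * b⁻¹ := by
      rw [pow_succ']; group
    rw [this, ih, ← conj_zpow, h, ← zpow_mul, pow_succ']

theorem IsPGroup.exists_pow_notMem_pow_mem {p : ℕ} (hG : IsPGroup p G) {A : Subgroup G} {y : G}
    (hy : y ∉ A) : ∃ k : ℕ, y ^ p ^ k ∉ A ∧ (y ^ p ^ k) ^ p ∈ A := by
  classical
  have hex : ∃ k, y ^ p ^ k ∈ A := (hG y).imp fun k (hk : y ^ p ^ k = 1) => by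
    rw [hk]; exact A.one_mem
  obtain ⟨k, hk⟩ : ∃ k, Nat.find hex = k + 1 := Nat.exists_eq_succ_of_ne_zero fun h0 =>
    hy (by simpa [h0] using Nat.find_spec hex)
  refine ⟨k, Nat.find_min hex (by omega), ?_⟩
  rw [← pow_mul, ← pow_succ, ← hk]
  exact Nat.find_spec hex

/-- The group has at most one subgroup of order `p`. -/
def AtMostOneSubgroupOfOrder (p : ℕ) (G : Type*) [Group G] : Prop :=
  ∀ x y : G, x ≠ 1 → x ^ p = 1 → y ^ p = 1 → y ∈ Subgroup.zpowers x

theorem AtMostOneSubgroupOfOrder.mem {p : ℕ} (hU : AtMostOneSubgroupOfOrder p G)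
    (hG : IsPGroup p G) {A : Subgroup G} (hA : A ≠ ⊥) {y : G} (hy : y ^ p = 1) : y ∈ A := by
  obtain ⟨x, hxA, hx⟩ := (Subgroup.bot_or_exists_ne_one A).resolve_left hA
  obtain ⟨k, hk, hk'⟩ := hG.exists_pow_notMem_pow_mem (A := ⊥) (y := x) (by simpa using hx)
  exact (Subgroup.zpowers_le.mpr (A.pow_mem hxA _))
    (hU _ y (by simpa using hk) (by simpa using hk') hy)

theorem mem_zpowers_zpow_of_not_dvd {p : ℕ} (hp : p.Prime) {a : G} {n : ℕ}
    (hn : orderOf a = p ^ n) {j : ℤ} (hpj : ¬ (p : ℤ) ∣ j) : a ∈ Subgroup.zpowers (a ^ j) := by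
  have : IsCoprime j (p : ℤ) :=
    (((Nat.prime_iff_prime_int.mp hp).coprime_iff_not_dvd).mpr hpj).symm
  obtain ⟨u, v, huv⟩ := this.pow_right (n := n)
  have hv : a ^ (v * (p : ℤ) ^ n) = 1 := by
    rw [← orderOf_dvd_iff_zpow_eq_one, hn]
    push_cast
    exact dvd_mul_left _ _
  refine ⟨u, ?_⟩
  dsimp only
  rw [← zpow_mul, mul_comm, eq_sub_of_add_eq huv, zpow_sub, hv]
  simp

/-- Let a ∈ A have maximal order. If ⟨a⟩ ≠ A, some w ∈ A outside ⟨a⟩ has w^p = a^j. If p ∣ j, then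
a^(-j/p) w is killed by p, so it lies in ⟨a⟩ by uniqueness, and so does w. Otherwise w has order p
times that of a. -/
theorem AtMostOneSubgroupOfOrder.exists_eq_zpowers [Finite G] {p : ℕ} (hp : p.Prime)
    (hU : AtMostOneSubgroupOfOrder p G)
    (hG : IsPGroup p G) (A : Subgroup G) (hA : ∀ x ∈ A, ∀ y ∈ A, x * y = y * x) :
    ∃ a, A = Subgroup.zpowers a := by
  have := Fact.mk hp
  obtain ⟨⟨a, haA⟩, ha⟩ := Finite.exists_max fun x : A => orderOf (x : G)
  refine ⟨a, le_antisymm (fun y hy => ?_) (Subgroup.zpowers_le.mpr haA)⟩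
  by_contra hya
  obtain ⟨k, hk, hk'⟩ := hG.exists_pow_notMem_pow_mem hya
  have hwA := A.pow_mem hy (p ^ k)
  generalize y ^ p ^ k = w at hk hk' hwA
  have ha1 : a ≠ 1 := by
    rintro rfl
    have := ha ⟨w, hwA⟩
    simp only [orderOf_one] at this
    have h1 : orderOf w = 1 := le_antisymm this (orderOf_pos w)
    rw [orderOf_eq_one_iff] at h1
    exact hk (by rw [h1]; exact Subgroup.one_mem _)
  obtain ⟨j, hj⟩ := hk'
  dsimp only at hj
  by_cases hpj : (p : ℤ) ∣ j
  · obtain ⟨i, rfl⟩ := hpj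
    have hcomm : Commute (a ^ (-i)) w := hA _ (A.zpow_mem haA _) _ hwA
    have h1 : (a ^ (-i) * w) ^ p = 1 := by
      rw [hcomm.mul_pow, ← hj, ← zpow_natCast, ← zpow_mul, ← zpow_add]
      simp [mul_comm]
    have h2 := hU.mem hG (A := Subgroup.zpowers a) (by simpa using ha1) h1
    exact hk ((Subgroup.mul_mem_cancel_left _ (Subgroup.zpow_mem_zpowers a _)).mp h2)
  · obtain ⟨n, hn⟩ := hG.exists_orderOf_eq_pow a
    have h1 : orderOf (w ^ p) = orderOf a := by
      rw [← hj]
      exact Nat.dvd_antisymm (orderOf_dvd_of_mem_zpowers ⟨j, rfl⟩)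
        (orderOf_dvd_of_mem_zpowers (mem_zpowers_zpow_of_not_dvd hp hn hpj))
    have hw1 : w ≠ 1 := fun h => hk (h ▸ Subgroup.one_mem _)
    have h2 : orderOf (w ^ p) * p = orderOf w := by
      rw [orderOf_pow_of_dvd hp.ne_zero (hG.dvd_orderOf hw1),
        Nat.div_mul_cancel (hG.dvd_orderOf hw1)]
    have h3 : orderOf w ≤ orderOf a := ha ⟨w, hwA⟩
    have h4 := orderOf_pos a
    have h5 := hp.two_le
    nlinarith

/-- A finite `p`-group has a normal abelian subgroup that is its own centralizer. -/
theorem IsPGroup.exists_normal_selfCentralizing [Finite G] {p : ℕ} [Fact p.Prime]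
    (hG : IsPGroup p G) :
    ∃ A : Subgroup G, A.Normal ∧ (∀ x ∈ A, ∀ y ∈ A, x * y = y * x) ∧
      ∀ x, (∀ y ∈ A, x * y = y * x) → x ∈ A := by
  obtain ⟨A, hA⟩ := Set.Finite.exists_maximal
    (s := {A : Subgroup G | A.Normal ∧ ∀ x ∈ A, ∀ y ∈ A, x * y = y * x}) (Set.toFinite _)
    ⟨⊥, inferInstance, by simp⟩
  obtain ⟨⟨hAn, hAc⟩, hmax⟩ := hA
  refine ⟨A, hAn, hAc, ?_⟩
  by_contra! hcon
  obtain ⟨x₀, hx₀, hx₀A⟩ := hcon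
  let C := Subgroup.centralizer (A : Set G)
  have hmemC : ∀ x, x ∈ C ↔ ∀ y ∈ A, x * y = y * x := fun x => by
    simp only [C, Subgroup.mem_centralizer_iff, SetLike.mem_coe]
    exact forall₂_congr fun _ _ => eq_comm
  let π := QuotientGroup.mk' A
  have hπ : ∀ x, π x = 1 ↔ x ∈ A := fun x => QuotientGroup.eq_one_iff x
  let D := C.map π
  have hCn : C.Normal := inferInstanceAs (Subgroup.centralizer (A : Set G)).Normal
  have : D.Normal := hCn.map π (QuotientGroup.mk'_surjective A)
  have hx₀D : π x₀ ∈ D := ⟨x₀, (hmemC x₀).mpr hx₀, rfl⟩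
  have hD : Nontrivial D := ⟨⟨⟨π x₀, hx₀D⟩, 1, fun h => hx₀A ((hπ _).mp (congrArg Subtype.val h))⟩⟩
  obtain ⟨m, hm0, hm⟩ := ((hG.to_quotient A).to_subgroup D).nontrivial_iff_card.mp hD
  -- The p-group G/A acts on `D` by conjugation and fixes 1, so it fixes another element. A lift c
  -- of it is central modulo A and centralizes A, so ⟨A, c⟩ is normal and abelian, against
  -- maximality.
  obtain ⟨⟨d, hdD⟩, hd, hd1⟩ := ((hG.to_quotient A).of_equiv
    ConjAct.toConjAct).exists_fixed_point_of_prime_dvd_card_of_fixed_point D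
      (hm ▸ dvd_pow_self p hm0.ne') (a := 1) (fun g => smul_one g)
  obtain ⟨c, hc, rfl⟩ := hdD
  have hcA : c ∉ A := fun h => hd1 (Subtype.ext ((hπ c).mpr h).symm)
  have hcent : ∀ g : G, g * c * g⁻¹ * c⁻¹ ∈ A := fun g => by
    have h1 := congrArg Subtype.val (hd (ConjAct.toConjAct (π g)))
    rw [ConjAct.Subgroup.val_conj_smul, ConjAct.toConjAct_smul] at h1
    rw [← hπ, map_mul, map_mul, map_mul, map_inv, map_inv, mul_inv_eq_one]
    exact h1
  rw [SetLike.mem_coe, hmemC] at hc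
  have hcomm : ∀ x ∈ A ⊔ Subgroup.zpowers c, ∀ y ∈ A ⊔ Subgroup.zpowers c, x * y = y * x := by
    have hgen : ∀ x ∈ (A : Set G) ∪ {c}, ∀ y ∈ (A : Set G) ∪ {c}, x * y = y * x := by
      rintro x (hx | rfl) y (hy | rfl)
      · exact hAc x hx y hy
      · exact (hc x hx).symm
      · exact hc y hy
      · rfl
    have hcl : A ⊔ Subgroup.zpowers c = Subgroup.closure ((A : Set G) ∪ {c}) := by
      rw [Subgroup.closure_union, Subgroup.closure_eq, Subgroup.zpowers_eq_closure]
    rw [hcl]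
    have := Subgroup.isMulCommutative_closure hgen
    intro x hx y hy
    exact congrArg Subtype.val (this.is_comm.comm ⟨x, hx⟩ ⟨y, hy⟩)
  have hnormal : (A ⊔ Subgroup.zpowers c).Normal := by
    refine ⟨fun x hx g => ?_⟩
    have hle : A ⊔ Subgroup.zpowers c ≤
        (A ⊔ Subgroup.zpowers c).comap (MulAut.conj g).toMonoidHom := by
      refine sup_le (fun y hy => ?_) (Subgroup.zpowers_le.mpr ?_)
      · exact Subgroup.mem_sup_left (hAn.conj_mem y hy g)
      · have h1 := Subgroup.mul_mem _ (Subgroup.mem_sup_left (T := Subgroup.zpowers c) (hcent g))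
          (Subgroup.mem_sup_right (S := A) (Subgroup.mem_zpowers c))
        rw [inv_mul_cancel_right] at h1
        exact h1
    exact hle hx
  exact hcA (hmax ⟨hnormal, hcomm⟩ le_sup_left
    (Subgroup.mem_sup_right (Subgroup.mem_zpowers c)))

end groups

/-! ### Groups with one subgroup of order p; choice of H₁ and H₂ -/

section classification

variable {G : Type u} [Group G]

theorem AtMostOneSubgroupOfOrder.conj_eq_inv {p : ℕ} (hp : p.Prime)
    (hU : AtMostOneSubgroupOfOrder p G) (hG : IsPGroup p G) {a : G} {n : ℕ}
    (hn : orderOf a = p ^ n) (hnormal : (Subgroup.zpowers a).Normal)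
    (hcent : ∀ x, x * a = a * x → x ∈ Subgroup.zpowers a) {b : G} (hb : b ∉ Subgroup.zpowers a)
    (hbp : b ^ p ∈ Subgroup.zpowers a) :
    p = 2 ∧ 2 ≤ n ∧ b * a * b⁻¹ = a⁻¹ ∧ b ^ 2 = a ^ 2 ^ (n - 1) := by
  have hdvd : ∀ k : ℤ, (p : ℤ) ^ n ∣ k ↔ a ^ k = 1 := fun k => by
    rw [← orderOf_dvd_iff_zpow_eq_one, hn, Nat.cast_pow]
  have hne : Subgroup.zpowers a ≠ ⊥ := by
    intro h
    rw [Subgroup.zpowers_eq_bot] at h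
    exact hb (hcent b (by simp [h]))
  obtain ⟨r, hr : a ^ r = b * a * b⁻¹⟩ := hnormal.conj_mem a (Subgroup.mem_zpowers a) b
  obtain ⟨j, hj : a ^ j = b ^ p⟩ := hbp
  -- Conjugation by b is a ↦ a^r: nontrivial as b does not centralize a, of p-th power trivial as
  -- b^p ∈ ⟨a⟩, and fixing b^p = a^j. If p ∤ j, then a would be a power of b^p and commute with b.
  have hr1 : ¬ (p : ℤ) ^ n ∣ r - 1 := by
    rw [hdvd, zpow_sub_one, hr, mul_inv_eq_one, mul_inv_eq_iff_eq_mul]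
    exact fun h => hb (hcent b h)
  have hrp : (p : ℤ) ^ n ∣ r ^ p - 1 := by
    rw [hdvd, zpow_sub_one, ← pow_conj_of_conj hr.symm p, ← hj]
    group
  have hjr : (p : ℤ) ^ n ∣ j * (r - 1) := by
    rw [hdvd, mul_sub_one, mul_comm, zpow_sub, zpow_mul, hr, conj_zpow, hj]
    group
  have hpj : (p : ℤ) ∣ j := by
    by_contra h
    have h1 := mem_zpowers_zpow_of_not_dvd hp hn h
    rw [hj] at h1
    obtain ⟨k, hk : (b ^ p) ^ k = a⟩ := h1
    refine hb (hcent b ?_)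
    rw [← hk]
    exact ((Commute.refl b).pow_right p).zpow_right k
  have hcase := exists_dvd_mul_geom_sum_add_or hp n hrp hjr hpj hr1
  rcases hcase with ⟨s, hs⟩ | ⟨rfl, hn2, hr', hj'⟩
  · exfalso
    rw [hdvd, zpow_add, hj, ← zpow_mul_pow_of_conj hr.symm] at hs
    exact hb ((Subgroup.mul_mem_cancel_left _ (Subgroup.zpow_mem_zpowers a s)).mp
      (hU.mem hG hne hs))
  · refine ⟨rfl, hn2, ?_, ?_⟩
    · have h1 := (hdvd (r + 1)).mp (by exact_mod_cast hr')
      rw [← hr]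
      rw [zpow_add_one] at h1
      exact eq_inv_of_mul_eq_one_left h1
    · obtain ⟨i, rfl⟩ := hj'
      have hpow : (2 : ℤ) ^ n = 2 ^ (n - 1) * 2 := by
        rw [← pow_succ, Nat.sub_add_cancel (by omega)]
      -- An even `i` would give b² = 1, and uniqueness would put b in ⟨a⟩.
      have hodd : Odd i := by
        rw [← Int.not_even_iff_odd]
        rintro ⟨k, rfl⟩
        have h1 : a ^ ((2 : ℤ) ^ (n - 1) * (k + k)) = 1 := by
          rw [← hdvd]
          refine ⟨k, ?_⟩
          push_cast
          rw [hpow]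
          ring
        exact hb (hU.mem hG hne (hj ▸ h1))
      obtain ⟨k, rfl⟩ := hodd
      have h1 : a ^ ((2 : ℤ) ^ n * k) = 1 := by
        rw [← hdvd]
        exact ⟨k, by push_cast; rfl⟩
      have h2 : (2 : ℤ) ^ (n - 1) * (2 * k + 1) = 2 ^ n * k + ((2 ^ (n - 1) : ℕ) : ℤ) := by
        rw [hpow]
        push_cast
        ring
      rw [← hj, h2, zpow_add, h1, one_mul, zpow_natCast]

theorem nonempty_mulEquiv_quaternionGroup {m : ℕ} {a b : G} (ha : orderOf a = 2 * m)
    (hb : b ∉ Subgroup.zpowers a) (hconj : b * a * b⁻¹ = a⁻¹) (hsq : b ^ 2 = a ^ m)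
    (hcover : ∀ g ∉ Subgroup.zpowers a, b⁻¹ * g ∈ Subgroup.zpowers a) :
    Nonempty (G ≃* QuaternionGroup m) := by
  have hzero : ∀ k : ℤ, a ^ k = 1 ↔ (k : ZMod (2 * m)) = 0 := fun k => by
    rw [ZMod.intCast_zmod_eq_zero_iff_dvd, ← orderOf_dvd_iff_zpow_eq_one, ha]
  -- `E` is k ↦ a^k, well defined on exponents modulo 2m.
  obtain ⟨E, hE⟩ : ∃ E : ZMod (2 * m) → G, ∀ k : ℤ, E k = a ^ k := by
    choose c hc using ZMod.intCast_surjective (n := 2 * m)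
    refine ⟨fun i => a ^ c i, fun k => ?_⟩
    rw [← mul_inv_eq_one, ← zpow_neg, ← zpow_add, hzero]
    push_cast
    rw [hc, add_neg_cancel]
  have hab : ∀ k : ℤ, a ^ k * b = b * a ^ (-k) := fun k => by
    have h1 : b * a ^ (-k) * b⁻¹ = a ^ k := by
      rw [← conj_zpow, hconj, inv_zpow, zpow_neg, inv_inv]
    rw [← h1, inv_mul_cancel_right]
  let f : QuaternionGroup m → G
    | .a i => E i
    | .xa i => b * E i
  have hf : ∀ x y, f (x * y) = f x * f y := by
    rintro (i | i) (j | j) <;> obtain ⟨i, rfl⟩ := ZMod.intCast_surjective i <;>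
      obtain ⟨j, rfl⟩ := ZMod.intCast_surjective j
    · rw [QuaternionGroup.a_mul_a, ← Int.cast_add]
      simp only [f, hE, zpow_add]
    · rw [QuaternionGroup.a_mul_xa, ← Int.cast_sub]
      simp only [f, hE]
      rw [← mul_assoc, hab, mul_assoc, ← zpow_add, sub_eq_neg_add]
    · rw [QuaternionGroup.xa_mul_a, ← Int.cast_add]
      simp only [f, hE, zpow_add, mul_assoc]
    · have hcast : (m : ZMod (2 * m)) + (j : ZMod (2 * m)) - (i : ZMod (2 * m)) =
          ((m + (-i + j) : ℤ) : ZMod (2 * m)) := by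
        push_cast
        ring
      rw [QuaternionGroup.xa_mul_xa, hcast]
      simp only [f, hE]
      rw [zpow_add, zpow_natCast, ← hsq, zpow_add, mul_assoc b, ← mul_assoc (a ^ i), hab, sq]
      simp only [mul_assoc]
  refine ⟨(MulEquiv.ofBijective (MonoidHom.mk' f hf) ⟨?_, ?_⟩).symm⟩
  · rw [injective_iff_map_eq_one]
    rintro (i | i) hi <;> obtain ⟨i, rfl⟩ := ZMod.intCast_surjective i
    · have h1 : a ^ i = 1 := (hE i).symm.trans hi
      rw [hzero] at h1
      rw [h1, QuaternionGroup.a_zero]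
    · have h1 : b * a ^ i = 1 := (congrArg (b * ·) (hE i).symm).trans hi
      refine absurd ?_ hb
      rw [eq_inv_of_mul_eq_one_left h1]
      exact Subgroup.inv_mem _ (Subgroup.zpow_mem_zpowers a i)
  · intro g
    by_cases hg : g ∈ Subgroup.zpowers a
    · obtain ⟨k, rfl⟩ := hg
      exact ⟨.a k, hE k⟩
    · obtain ⟨k, hk : a ^ k = b⁻¹ * g⟩ := hcover g hg
      refine ⟨.xa k, ?_⟩
      change b * E k = g
      rw [hE, hk, mul_inv_cancel_left]

/-- A finite `p`-group with at most one subgroup of order `p` is cyclic or a generalized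
quaternion group. -/
theorem AtMostOneSubgroupOfOrder.isNiceGroup [Finite G] {p : ℕ} (hp : p.Prime)
    (hU : AtMostOneSubgroupOfOrder p G) (hG : IsPGroup p G) : IsNiceGroup G := by
  have := Fact.mk hp
  obtain ⟨A, hnormal, hcomm, hcent⟩ := hG.exists_normal_selfCentralizing
  obtain ⟨a, rfl⟩ := hU.exists_eq_zpowers hp hG A hcomm
  have hcent' : ∀ x, x * a = a * x → x ∈ Subgroup.zpowers a := by
    intro x hx
    refine hcent x ?_
    rintro _ ⟨k, rfl⟩
    exact Commute.zpow_right hx k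
  obtain ⟨n, hn⟩ := hG.exists_orderOf_eq_pow a
  by_cases htop : ∀ g, g ∈ Subgroup.zpowers a
  · exact Or.inl ⟨p, hp, hG, ⟨a, htop⟩⟩
  push Not at htop
  obtain ⟨g, hg⟩ := htop
  have key : ∀ b, b ∉ Subgroup.zpowers a → b ^ p ∈ Subgroup.zpowers a → _ := fun b hb hbp =>
    hU.conj_eq_inv hp hG hn hnormal hcent' hb hbp
  obtain ⟨k, hk, hk'⟩ := hG.exists_pow_notMem_pow_mem hg
  obtain ⟨rfl, hn2, -, -⟩ := key _ hk hk'
  clear hk hk' k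
  have hsq : ∀ b, b ∉ Subgroup.zpowers a → b ^ 2 ∈ Subgroup.zpowers a := by
    intro b hb
    obtain ⟨k, hk, hk'⟩ := hG.exists_pow_notMem_pow_mem hb
    rcases k with _ | k
    · simpa using hk'
    -- Otherwise inversion of a is the square of the automorphism a ↦ a^r, so r² ≡ -1 modulo 2^n
    -- with n ≥ 2; but -1 is not a square modulo 4.
    exfalso
    obtain ⟨-, -, hinv, -⟩ := key _ hk hk'
    obtain ⟨r, hr : a ^ r = _⟩ := hnormal.conj_mem a (Subgroup.mem_zpowers a) (b ^ 2 ^ k)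
    rw [pow_succ, pow_mul, pow_conj_of_conj hr.symm 2, ← mul_eq_one_iff_eq_inv, ← zpow_add_one,
      ← orderOf_dvd_iff_zpow_eq_one, hn] at hinv
    have h4 : (4 : ℤ) ∣ r ^ 2 + 1 := by
      refine Dvd.dvd.trans ?_ hinv
      push_cast
      exact pow_dvd_pow 2 hn2
    rcases Int.even_or_odd' r with ⟨c, rfl | rfl⟩ <;> ring_nf at h4 <;> omega
  obtain ⟨-, -, hinv, hg2⟩ := key g hg (hsq g hg)
  refine Or.inr ⟨2 ^ (n - 1), ?_, ?_, hG.exists_card_eq⟩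
  · calc 2 = 2 ^ 1 := rfl
      _ ≤ 2 ^ (n - 1) := Nat.pow_le_pow_right (by norm_num) (by omega)
  · refine nonempty_mulEquiv_quaternionGroup (a := a) (b := g) ?_ hg hinv hg2 fun x hx => ?_
    · rw [hn, ← pow_succ', Nat.sub_add_cancel (by omega)]
    -- Both x and g invert a, so g⁻¹x centralizes a and lies in ⟨a⟩.
    · obtain ⟨-, -, hinv', -⟩ := key x hx (hsq x hx)
      apply hcent'
      rw [← hinv] at hinv'
      have h1 : x * a = g * a * g⁻¹ * x := by rw [← hinv', inv_mul_cancel_right]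
      rw [mul_assoc, h1]
      group

/-- A finite group that is not nice has nontrivial subgroups `H₁` and `H₂` such that no conjugate
of `H₁` meets `H₂` nontrivially. -/
theorem exists_subgroups_of_not_isNiceGroup [Finite G] (hG : ¬ IsNiceGroup G) :
    ∃ H₁ H₂ : Subgroup G, H₁ ≠ ⊥ ∧ H₂ ≠ ⊥ ∧
      ∀ g : G, ∀ x ∈ H₁, g * x * g⁻¹ ∈ H₂ → x = 1 := by
  have hcard : Nat.card G ≠ 1 := by
    intro h
    have := (Nat.card_eq_one_iff_unique.mp h).1
    exact hG (Or.inl ⟨2, Nat.prime_two, IsPGroup.of_subsingleton 2 G, inferInstance⟩)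
  obtain ⟨p, hp, hpG⟩ := Nat.exists_prime_and_dvd hcard
  have := Fact.mk hp
  by_cases hpgroup : IsPGroup p G
  · have : Nontrivial G := by
      rw [← not_subsingleton_iff_nontrivial]
      exact fun _ => hcard (Nat.card_of_subsingleton 1)
    have := hpgroup.center_nontrivial
    have hpc : p ∣ Nat.card (Subgroup.center G) :=
      (hpgroup.to_subgroup _).card_eq_or_dvd.resolve_left Finite.one_lt_card.ne'
    obtain ⟨⟨z, hz⟩, hzp⟩ := exists_prime_orderOf_dvd_card' p hpc
    rw [Subgroup.orderOf_mk] at hzp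
    have hz1 : z ≠ 1 := by
      rintro rfl
      exact hp.ne_one (by simpa using hzp.symm)
    obtain ⟨y, hy, hyz⟩ : ∃ y : G, y ^ p = 1 ∧ y ∉ Subgroup.zpowers z := by
      by_contra! hcon
      refine hG (AtMostOneSubgroupOfOrder.isNiceGroup hp (fun x y hx hxp hyp => ?_) hpgroup)
      have h1 : Subgroup.zpowers x ≤ Subgroup.zpowers z := Subgroup.zpowers_le.mpr (hcon x hxp)
      have h2 : Subgroup.zpowers x = Subgroup.zpowers z := by
        refine Subgroup.eq_of_le_of_card_ge h1 ?_
        rw [Nat.card_zpowers, Nat.card_zpowers, hzp, orderOf_eq_prime hxp hx]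
      rw [h2]
      exact hcon y hyp
    have hy1 : y ≠ 1 := fun h => hyz (h ▸ Subgroup.one_mem _)
    refine ⟨Subgroup.zpowers z, Subgroup.zpowers y, by simpa using hz1, by simpa using hy1, ?_⟩
    rintro g _ ⟨k, rfl⟩ hk
    dsimp only at hk ⊢
    have hzk : z ^ k ∈ Subgroup.center G := Subgroup.zpow_mem _ hz k
    rw [Subgroup.mem_center_iff.mp hzk g, mul_inv_cancel_right] at hk
    by_contra hne
    have hzkp : (z ^ k) ^ p = 1 := by
      rw [← zpow_natCast, zpow_comm, zpow_natCast, ← hzp, pow_orderOf_eq_one, one_zpow]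
    -- As z^k is central, conjugation has no effect; if nontrivial, z^k generates both ⟨z⟩ and ⟨y⟩,
    -- contradicting the choice of y.
    have h1 : Subgroup.zpowers (z ^ k) = Subgroup.zpowers y := by
      refine Subgroup.eq_of_le_of_card_ge (Subgroup.zpowers_le.mpr hk) ?_
      rw [Nat.card_zpowers, Nat.card_zpowers, orderOf_eq_prime hy hy1, orderOf_eq_prime hzkp hne]
    have h2 : y ∈ Subgroup.zpowers (z ^ k) := h1 ▸ Subgroup.mem_zpowers y
    exact hyz (Subgroup.zpowers_le.mpr (Subgroup.zpow_mem_zpowers z k) h2)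
  · obtain ⟨q, hq, hqG, hqp⟩ : ∃ q, q.Prime ∧ q ∣ Nat.card G ∧ q ≠ p := by
      by_contra! hcon
      exact hpgroup (IsPGroup.of_card (Nat.eq_prime_pow_of_unique_prime_dvd
        Nat.card_pos.ne' fun {d} hd hdG => hcon d hd hdG))
    have := Fact.mk hq
    obtain ⟨x, hx⟩ := exists_prime_orderOf_dvd_card' p hpG
    obtain ⟨y, hy⟩ := exists_prime_orderOf_dvd_card' q hqG
    have hx1 : x ≠ 1 := by
      rintro rfl
      exact hp.ne_one (by simpa using hx.symm)
    have hy1 : y ≠ 1 := by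
      rintro rfl
      exact hq.ne_one (by simpa using hy.symm)
    refine ⟨Subgroup.zpowers x, Subgroup.zpowers y, by simpa using hx1, by simpa using hy1, ?_⟩
    intro g w hw hgw
    have h1 := orderOf_dvd_of_mem_zpowers hw
    have h2 := orderOf_dvd_of_mem_zpowers hgw
    have h3 : orderOf (g * w * g⁻¹) = orderOf w := (MulAut.conj g).orderOf_eq w
    rw [h3, hy] at h2
    rw [hx] at h1
    rw [← orderOf_eq_one_iff]
    exact Nat.eq_one_of_dvd_coprimes ((Nat.coprime_primes hp hq).mpr hqp.symm) h1 h2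

end classification

theorem theorem1 {G : Type u} [Group G] [Finite G] (hG : ¬ IsNiceGroup G) :
    ∃ K₁ K₂ : FiniteGComplex.{u, u} G, K₁.IsFree ∧ K₂.IsFree ∧
      mappingIndex G K₁.Realization = 1 ∧ mappingIndex G K₂.Realization = 1 ∧
      mappingIndex G (K₁.Realization × K₂.Realization) = 0 ∧
      mappingIndex G (K₁.Realization × K₂.Realization) ≠
        min (mappingIndex G K₁.Realization) (mappingIndex G K₂.Realization) := by
  obtain ⟨H₁, H₂, h₁, h₂, h⟩ := exists_subgroups_of_not_isNiceGroup hG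
  refine ⟨cosetGraph H₁, cosetGraph H₂, cosetGraph_isFree H₁, cosetGraph_isFree H₂,
    mappingIndex_cosetGraph h₁, mappingIndex_cosetGraph h₂, mappingIndex_prod_cosetGraph h, ?_⟩
  rw [mappingIndex_cosetGraph h₁, mappingIndex_cosetGraph h₂, mappingIndex_prod_cosetGraph h]
  simp
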